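/- Let $\mathbf{H}^3$ be hyperbolic $3$-space in the upper half space model $\mathbb{C}\times(0,\infty)$, with its distance $d$ of constant curvature $-1$, given by $\sinh\big(\tfrac12 d(p,q)\big)=\dfrac{|p-q|}{2\sqrt{ts}}$, where $t,s$ are the heights of $p,q$ and $|p-q|$ is the Euclidean distance. Let $\mathbf{S}=\mathbb{C}\cup\{\infty\}$ be the Riemann sphere, and give $\mathbf{H}^3\cup\mathbf{S}$ the topology of the closed upper half space $\mathbb{C}\times[0,\infty)$ (with $\mathbb{C}=\mathbb{C}\times\{0\}$) together with $\infty$, as a subspace of the one-point compactification of $\mathbb{C}\times\mathbb{R}$. A bijection $H:\mathbf{H}^3\to\mathbf{H}^3$ is *bi-Lipschitz* if there is $K\ge 1$ with $K^{-1}d(x,y)\le d(H(x),H(y))\le K\,d(x,y)$ for all $x,y$. A homeomorphism $h:\mathbf{S}\to\mathbf{S}$ is a *continuous extension* of $H$ if the map of $\mathbf{H}^3\cup\mathbf{S}$ that equals $H$ on $\mathbf{H}^3$ and $h$ on $\mathbf{S}$ is continuous. A *nice lattice* is a group $\Gamma$ of isometries of $\mathbf{H}^3$ such that $\mathbf{H}^3/\Gamma$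 is a compact (Hausdorff) manifold and $\mathbf{H}^3\to\mathbf{H}^3/\Gamma$ is a covering map with deck group $\Gamma$; its elements act on $\mathbf{S}$ through their continuous extensions. **Theorem.** Every bi-Lipschitz map $H:\mathbf{H}^3\to\mathbf{H}^3$ has a continuous extension to a homeomorphism $h:\mathbf{S}\to\mathbf{S}$. Moreover, whenever $\Gamma_1,\Gamma_2$ are nice lattices with $H\Gamma_1H^{-1}=\Gamma_2$ (as groups of bijections of $\mathbf{H}^3$), one also has $h\Gamma_1h^{-1}=\Gamma_2$ (as groups of homeomorphisms of $\mathbf{S}$). -/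

import Mathlib

noncomputable section

/-- A bi-Lipschitz (BL) map of metric spaces: a bijection distorting distances by at most a
constant factor `K ≥ 1` in both directions. -/
def IsBL {X₁ X₂ : Type*} [MetricSpace X₁] [MetricSpace X₂] (H : X₁ → X₂) : Prop :=
  Function.Bijective H ∧
    ∃ K : ℝ, 1 ≤ K ∧ ∀ x y : X₁, K⁻¹ * dist x y ≤ dist (H x) (H y) ∧ dist (H x) (H y) ≤ K * dist x y

/-- The points of hyperbolic 3-space in the upper half space model `ℂ × (0, ∞)`. -/
@[ext]
structure H3 where
  z : ℂ
  t : ℝ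
  t_pos : 0 < t

namespace H3

/-- The point as an element of `ℂ × ℝ` with its Euclidean norm. -/
def toEuclidean (p : H3) : WithLp 2 (ℂ × ℝ) := WithLp.toLp 2 (p.z, p.t)

/-- The mirror image of the point in the plane `t = 0`. -/
def mirror (p : H3) : WithLp 2 (ℂ × ℝ) := WithLp.toLp 2 (p.z, -p.t)

/-- The hyperbolic distance (curvature `-1`), given by the same formula as on Mathlib's upper half
plane: `sinh (d / 2) = |p - q| / (2 √(t s))`, where `|p - q|` is Euclidean and `t`, `s` are the
heights of `p`, `q`. -/
instance : Dist H3 :=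
  ⟨fun p q => 2 * Real.arsinh (dist p.toEuclidean q.toEuclidean / (2 * √(p.t * q.t)))⟩

theorem dist_def (p q : H3) :
    dist p q = 2 * Real.arsinh (dist p.toEuclidean q.toEuclidean / (2 * √(p.t * q.t))) := rfl

theorem dist_toEuclidean_sq (p q : H3) :
    dist p.toEuclidean q.toEuclidean ^ 2 = dist p.z q.z ^ 2 + (p.t - q.t) ^ 2 := by
  rw [WithLp.prod_dist_eq_of_L2, Real.sq_sqrt (by positivity)]
  simp [toEuclidean, Real.dist_eq, sq_abs]

theorem dist_mirror_sq (p q : H3) :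
    dist p.toEuclidean q.mirror ^ 2 = dist p.z q.z ^ 2 + (p.t + q.t) ^ 2 := by
  rw [WithLp.prod_dist_eq_of_L2, Real.sq_sqrt (by positivity)]
  simp [toEuclidean, mirror, Real.dist_eq, sq_abs]

theorem dist_mirror_comm (p q : H3) :
    dist p.toEuclidean q.mirror = dist q.toEuclidean p.mirror := by
  rw [← sq_eq_sq₀ dist_nonneg dist_nonneg, dist_mirror_sq, dist_mirror_sq, dist_comm, add_comm p.t]

theorem dist_self_mirror (p : H3) : dist p.toEuclidean p.mirror = 2 * p.t := by
  have := p.t_pos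
  rw [← sq_eq_sq₀ dist_nonneg (by positivity), dist_mirror_sq, dist_self]
  ring

theorem sinh_half_dist (p q : H3) :
    Real.sinh (dist p q / 2) = dist p.toEuclidean q.toEuclidean / (2 * √(p.t * q.t)) := by
  rw [dist_def, mul_div_cancel_left₀ _ two_ne_zero, Real.sinh_arsinh]

theorem cosh_half_dist (p q : H3) :
    Real.cosh (dist p q / 2) = dist p.toEuclidean q.mirror / (2 * √(p.t * q.t)) := by
  have hp := p.t_pos
  have hq := q.t_pos
  rw [← sq_eq_sq₀ (Real.cosh_pos _).le (by positivity), Real.cosh_sq', sinh_half_dist, div_pow,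
    div_pow, mul_pow, Real.sq_sqrt (by positivity), dist_toEuclidean_sq, dist_mirror_sq]
  field_simp
  ring

protected theorem dist_triangle (a b c : H3) : dist a c ≤ dist a b + dist b c := by
  have ha := a.t_pos
  have hb := b.t_pos
  have hc := c.t_pos
  have pt := EuclideanGeometry.mul_dist_le_mul_dist_add_mul_dist
    a.toEuclidean b.toEuclidean c.toEuclidean b.mirror
  rw [dist_self_mirror, dist_mirror_comm c b] at pt
  have key : Real.sinh (dist a c / 2) ≤ Real.sinh (dist a b / 2 + dist b c / 2) := by
    rw [Real.sinh_add, sinh_half_dist, sinh_half_dist, sinh_half_dist, cosh_half_dist,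
      cosh_half_dist, Real.sqrt_mul ha.le, Real.sqrt_mul ha.le, Real.sqrt_mul hb.le]
    have hb' : b.t = √b.t * √b.t := (Real.mul_self_sqrt hb.le).symm
    have ha0 : 0 < √a.t := Real.sqrt_pos.2 ha
    have hb0 : 0 < √b.t := Real.sqrt_pos.2 hb
    have hc0 : 0 < √c.t := Real.sqrt_pos.2 hc
    rw [div_mul_div_comm, div_mul_div_comm, ← add_div, div_le_div_iff₀ (by positivity)
      (by positivity)]
    have h2 : 0 ≤ 2 * (√a.t * √c.t) := by positivity
    calc dist a.toEuclidean c.toEuclidean * (2 * (√a.t * √b.t) * (2 * (√b.t * √c.t)))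
        = dist a.toEuclidean c.toEuclidean * (2 * (√b.t * √b.t)) * (2 * (√a.t * √c.t)) := by ring
      _ = dist a.toEuclidean c.toEuclidean * (2 * b.t) * (2 * (√a.t * √c.t)) := by rw [← hb']
      _ ≤ _ := mul_le_mul_of_nonneg_right (by linarith) h2
  rw [Real.sinh_le_sinh] at key
  linarith

instance : MetricSpace H3 where
  dist := dist
  dist_self p := by simp [dist_def]
  dist_comm p q := by simp only [dist_def, dist_comm p.toEuclidean, mul_comm p.t]
  dist_triangle := H3.dist_triangle
  eq_of_dist_eq_zero {p q} h := by
    have hp := p.t_pos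
    have hq := q.t_pos
    have h0 : dist p.toEuclidean q.toEuclidean = 0 := by
      have := sinh_half_dist p q
      rw [h, zero_div, Real.sinh_zero, eq_comm, div_eq_zero_iff] at this
      exact this.resolve_right (by positivity)
    have h1 : p.toEuclidean = q.toEuclidean := dist_eq_zero.1 h0
    simp only [toEuclidean, (WithLp.toLp_injective 2).eq_iff, Prod.mk.injEq] at h1
    exact H3.ext h1.1 h1.2

/-- The isometry group acts on hyperbolic space by evaluation. -/
instance : MulAction (H3 ≃ᵢ H3) H3 where
  smul g p := g p
  one_smul _ := rfl
  mul_smul _ _ _ := rfl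

end H3

/-- The Riemann sphere `ℂ ∪ {∞}`. -/
abbrev RiemannSphere : Type := OnePoint ℂ

/-- Hyperbolic 3-space together with its ideal boundary, the Riemann sphere. -/
inductive ClosedH3 : Type
  | interior (p : H3) : ClosedH3
  | ideal (ξ : RiemannSphere) : ClosedH3

namespace ClosedH3

/-- The inclusion of the closed half space `ℂ × [0, ∞)`, with a point at infinity added, in the
one-point compactification of `ℂ × ℝ`; the Riemann sphere is `(ℂ × {0}) ∪ {∞}`. -/
def toOnePoint : ClosedH3 → OnePoint (ℂ × ℝ)
  | interior p => ((p.z, p.t) : ℂ × ℝ)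
  | ideal ξ => OnePoint.map (fun z : ℂ => ((z, 0) : ℂ × ℝ)) ξ

/-- The topology of the closed ball. -/
instance : TopologicalSpace ClosedH3 := TopologicalSpace.induced toOnePoint inferInstance

/-- The map which is `H` on hyperbolic space and `h` on the Riemann sphere. -/
def glue (H : H3 → H3) (h : RiemannSphere → RiemannSphere) : ClosedH3 → ClosedH3
  | interior p => interior (H p)
  | ideal ξ => ideal (h ξ)

end ClosedH3

/-- `h` is a continuous extension of `H` to the Riemann sphere: together they form a continuous
self-map of hyperbolic space with its ideal boundary. -/
def ExtendsContinuouslyTo (H : H3 → H3) (h : RiemannSphere → RiemannSphere) : Prop :=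
  Continuous (ClosedH3.glue H h)

/-- A nice lattice (co-compact torsion-free lattice): a group `Γ` of isometries of hyperbolic
3-space such that the quotient is a compact (Hausdorff) manifold, the projection to the quotient
being a covering map with deck group `Γ`. -/
structure IsNiceLattice (Γ : Subgroup (H3 ≃ᵢ H3)) : Prop where
  covering : IsQuotientCoveringMap (Quotient.mk (MulAction.orbitRel Γ H3)) Γ
  t2 : T2Space (MulAction.orbitRel.Quotient Γ H3)
  compact : CompactSpace (MulAction.orbitRel.Quotient Γ H3)

/-- `H Γ₁ H⁻¹ = Γ₂`, as sets of bijections of hyperbolic space. -/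
def IsEquivariant (H : Equiv.Perm H3) (Γ₁ Γ₂ : Subgroup (H3 ≃ᵢ H3)) : Prop :=
  (fun g : H3 ≃ᵢ H3 => H * g.toEquiv * H⁻¹) '' Γ₁ = (fun g : H3 ≃ᵢ H3 => g.toEquiv) '' Γ₂

/-- The group `Γ` of isometries, acting on the Riemann sphere: the homeomorphisms of the sphere
which are continuous extensions of elements of `Γ`. -/
def boundaryMaps (Γ : Subgroup (H3 ≃ᵢ H3)) : Set (RiemannSphere ≃ₜ RiemannSphere) :=
  {k | ∃ g ∈ Γ, ExtendsContinuouslyTo g k}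

/-- `h Γ₁ h⁻¹ = Γ₂`, as sets of homeomorphisms of the Riemann sphere. -/
def IsBoundaryEquivariant (h : RiemannSphere ≃ₜ RiemannSphere) (Γ₁ Γ₂ : Subgroup (H3 ≃ᵢ H3)) :
    Prop :=
  (fun k => h * k * h⁻¹) '' boundaryMaps Γ₁ = boundaryMaps Γ₂

end

/-!
In the ball model, obtained from the half space by a Euclidean inversion, two points at hyperbolic
distance `d` have Euclidean distance `sinh (d / 2) / (cosh (a / 2) * cosh (b / 2))`, where `a` and
`b` are their distances from the center. A point of height at most `r` is at least `-log r` away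
from `(0, 1)`, so its image under a quasi-isometric embedding with constant `K` is at distance at
least `-K⁻¹ * log r` up to a bounded error. Steps of hyperbolic length at most one below height `r`
thus map to steps of Euclidean size `O(r ^ K⁻¹)` in the ball. Descending a vertical line by halving
the height, these sizes form a geometric series, and the map is Cauchy at every finite ideal point.
Inversion in the unit sphere is an isometry and reduces the point `∞` to the point `0`. The limits
are ideal because they are infinitely far away, those of a bijection and its inverse are mutually
inverse, and conjugating by `H` and by `h` preserves continuity of the combined maps.
-/

open Filter Topology Set

section QuasiIsometry

variable {X₁ X₂ : Type*} [PseudoMetricSpace X₁] [PseudoMetricSpace X₂]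

/-- A quasi-isometric embedding: distances are preserved up to a constant factor and a constant
error. This is all that the behaviour of a map at infinity depends on. -/
def IsQuasiIsometricEmbedding (F : X₁ → X₂) : Prop :=
  ∃ K c : ℝ, 1 ≤ K ∧ 0 ≤ c ∧
    ∀ x y, K⁻¹ * dist x y - c ≤ dist (F x) (F y) ∧ dist (F x) (F y) ≤ K * dist x y + c

theorem IsBL.isQuasiIsometricEmbedding {X₁ X₂ : Type*} [MetricSpace X₁] [MetricSpace X₂]
    {F : X₁ → X₂} (hF : IsBL F) :
    IsQuasiIsometricEmbedding F := by
  obtain ⟨-, K, hK, h⟩ := hF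
  exact ⟨K, 0, hK, le_rfl, by simpa using h⟩

theorem IsBL.continuous {X₁ X₂ : Type*} [MetricSpace X₁] [MetricSpace X₂] {F : X₁ → X₂}
    (hF : IsBL F) : Continuous F := by
  obtain ⟨-, K, -, h⟩ := hF
  exact (LipschitzWith.of_dist_le' fun x y => (h x y).2).continuous

namespace IsQuasiIsometricEmbedding

theorem symm {F : X₁ ≃ X₂} (hF : IsQuasiIsometricEmbedding F) :
    IsQuasiIsometricEmbedding F.symm := by
  obtain ⟨K, c, hK, hc, h⟩ := hF
  have hK0 : 0 < K := one_pos.trans_le hK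
  refine ⟨K, K * c, hK, mul_nonneg hK0.le hc, fun x y => ?_⟩
  have hxy := h (F.symm x) (F.symm y)
  rw [F.apply_symm_apply, F.apply_symm_apply] at hxy
  constructor
  · have hcK : c ≤ K * (K * c) := by nlinarith [mul_nonneg hK0.le hc]
    rw [sub_le_iff_le_add, inv_mul_le_iff₀ hK0]
    linarith
  · rw [← mul_add, ← inv_mul_le_iff₀ hK0]
    linarith

theorem comp_isometry {X₀ : Type*} [PseudoMetricSpace X₀] {F : X₁ → X₂} {G : X₀ → X₁}
    (hF : IsQuasiIsometricEmbedding F) (hG : Isometry G) : IsQuasiIsometricEmbedding (F ∘ G) := by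
  obtain ⟨K, c, hK, hc, h⟩ := hF
  exact ⟨K, c, hK, hc, fun x y => hG.dist_eq x y ▸ h (G x) (G y)⟩

theorem exists_mul_dist_sub_le_dist {F : X₁ → X₂} (hF : IsQuasiIsometricEmbedding F) (x₀ : X₁)
    (y₀ : X₂) : ∃ α b : ℝ, 0 < α ∧ ∀ x, α * dist x₀ x - b ≤ dist y₀ (F x) := by
  obtain ⟨K, c, hK, -, h⟩ := hF
  refine ⟨K⁻¹, c + dist y₀ (F x₀), inv_pos.2 (one_pos.trans_le hK), fun x => ?_⟩
  linarith [(h x₀ x).1, dist_triangle_left (F x₀) (F x) y₀]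

theorem exists_dist_le_of_dist_le {F : X₁ → X₂} (hF : IsQuasiIsometricEmbedding F) (r : ℝ) :
    ∃ D : ℝ, ∀ x y, dist x y ≤ r → dist (F x) (F y) ≤ D := by
  obtain ⟨K, c, hK, -, h⟩ := hF
  exact ⟨K * r + c, fun x y hxy => (h x y).2.trans (by gcongr)⟩

end IsQuasiIsometricEmbedding

end QuasiIsometry

section Inversion

open EuclideanGeometry

variable {E : Type*} [NormedAddCommGroup E] [InnerProductSpace ℝ E]

theorem tendsto_inversion_cobounded (c : E) (R : ℝ) :
    Tendsto (inversion c R) (Bornology.cobounded E) (𝓝 c) := by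
  rw [tendsto_iff_dist_tendsto_zero]
  simp only [dist_inversion_center]
  exact (Metric.tendsto_dist_right_cobounded_atTop c).const_div_atTop _

/-- Inversion in the sphere with center `c` and radius `R`, extended by `∞ ↦ c`. The junk value
`c ↦ c` of the library's `inversion` makes it non-injective and discontinuous at `c`. -/
noncomputable def inversionOnePoint (c : E) (R : ℝ) (x : OnePoint E) : E :=
  x.elim c (inversion c R)

theorem injOn_inversionOnePoint (c : E) {R : ℝ} (hR : R ≠ 0) :
    InjOn (inversionOnePoint c R) {(c : OnePoint E)}ᶜ := by
  intro x hx y hy h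
  cases x with
  | infty =>
    cases y with
    | infty => rfl
    | coe y => exact absurd (congrArg _ ((center_eq_inversion hR).1 h)) hy
  | coe x =>
    cases y with
    | infty => exact absurd (congrArg _ ((inversion_eq_center hR).1 h)) hx
    | coe y => exact congrArg _ (inversion_injective c hR h)

theorem continuousAt_inversionOnePoint [ProperSpace E] {c : E} (R : ℝ) {x : OnePoint E}
    (hx : x ≠ c) : ContinuousAt (inversionOnePoint c R) x := by
  cases x with
  | infty =>
    rw [OnePoint.continuousAt_infty', coclosedCompact_eq_cocompact, ← Metric.cobounded_eq_cocompact]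
    exact tendsto_inversion_cobounded c R
  | coe x =>
    rw [OnePoint.continuousAt_coe]
    exact continuousAt_const.inversion continuousAt_const continuousAt_id
      fun h => hx (congrArg _ h)

end Inversion

namespace H3

/-- The base point of hyperbolic space, which becomes the center of the ball model. -/
def origin : H3 := ⟨0, 1, one_pos⟩

theorem dist_toEuclidean (p q : H3) :
    dist p.toEuclidean q.toEuclidean = 2 * √(p.t * q.t) * Real.sinh (dist p q / 2) := by
  have h : 0 < p.t * q.t := mul_pos p.t_pos q.t_pos
  rw [sinh_half_dist, mul_div_cancel₀ _ (by positivity)]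

theorem dist_toEuclidean_mirror (p q : H3) :
    dist p.toEuclidean q.mirror = 2 * √(p.t * q.t) * Real.cosh (dist p q / 2) := by
  have h : 0 < p.t * q.t := mul_pos p.t_pos q.t_pos
  rw [cosh_half_dist, mul_div_cancel₀ _ (by positivity)]

theorem dist_le_dist_toEuclidean_div_sqrt (p q : H3) :
    dist p q ≤ dist p.toEuclidean q.toEuclidean / √(p.t * q.t) := by
  have h : 0 < p.t * q.t := mul_pos p.t_pos q.t_pos
  have hsinh : dist p q / 2 ≤ Real.sinh (dist p q / 2) := Real.self_le_sinh_iff.2 (by positivity)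
  rw [le_div_iff₀ (by positivity), dist_toEuclidean]
  nlinarith [Real.sqrt_pos.2 h]

theorem dist_le_one_of_sq_le {p q : H3} (h : dist p.z q.z ^ 2 + (p.t - q.t) ^ 2 ≤ p.t * q.t) :
    dist p q ≤ 1 :=
  (dist_le_dist_toEuclidean_div_sqrt p q).trans <| div_le_one_of_le₀
    (Real.le_sqrt_of_sq_le <| (dist_toEuclidean_sq p q).trans_le h) (Real.sqrt_nonneg _)

theorem t_le_t_mul_exp_dist (p q : H3) : p.t ≤ q.t * Real.exp (dist p q) := by
  have hp := p.t_pos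
  have hpq : 0 < p.t * q.t := mul_pos hp q.t_pos
  have h : p.t ≤ √(p.t * q.t) * Real.exp (dist p q / 2) := by
    have tri := dist_triangle_left p.toEuclidean p.mirror q.toEuclidean
    rw [dist_self_mirror, dist_toEuclidean, dist_toEuclidean_mirror, dist_comm q,
      mul_comm q.t] at tri
    rw [← Real.cosh_add_sinh]
    linarith
  refine le_of_mul_le_mul_left ?_ hp
  calc p.t * p.t ≤ (√(p.t * q.t) * Real.exp (dist p q / 2)) ^ 2 := by
        rw [sq]
        exact mul_self_le_mul_self hp.le h
    _ = p.t * (q.t * Real.exp (dist p q)) := by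
        rw [mul_pow, Real.sq_sqrt hpq.le, ← Real.exp_nat_mul, Nat.cast_two,
          mul_div_cancel₀ _ two_ne_zero, mul_assoc]

theorem neg_log_t_le_dist_origin (p : H3) : -Real.log p.t ≤ dist origin p := by
  have h : 1 ≤ p.t * Real.exp (dist origin p) := t_le_t_mul_exp_dist origin p
  have := Real.log_nonneg h
  rw [Real.log_mul p.t_pos.ne' (Real.exp_pos _).ne', Real.log_exp] at this
  linarith

theorem continuous_toEuclidean : Continuous toEuclidean := by
  refine continuous_iff_continuousAt.2 fun p => tendsto_iff_dist_tendsto_zero.2 ?_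
  have bound (q : H3) : dist q.toEuclidean p.toEuclidean ≤
      2 * √(p.t * Real.exp (dist q p) * p.t) * Real.sinh (dist q p / 2) := by
    have hp := p.t_pos.le
    have ht := t_le_t_mul_exp_dist q p
    have : 0 ≤ Real.sinh (dist q p / 2) := Real.sinh_nonneg_iff.2 (by positivity)
    rw [dist_toEuclidean]
    gcongr
  have lim : Continuous fun d : ℝ => 2 * √(p.t * Real.exp d * p.t) * Real.sinh (d / 2) := by
    fun_prop
  have hdist : Tendsto (dist · p) (𝓝 p) (𝓝 0) := tendsto_iff_dist_tendsto_zero.1 tendsto_id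
  refine squeeze_zero (fun _ => dist_nonneg) bound ?_
  simpa [Function.comp_def] using (lim.tendsto 0).comp hdist

theorem isInducing_toEuclidean : IsInducing toEuclidean := by
  refine isInducing_iff_nhds.2 fun p =>
    le_antisymm continuous_toEuclidean.continuousAt.le_comap ?_
  refine tendsto_id'.1 (tendsto_iff_dist_tendsto_zero.2 ?_)
  have hp : √(p.toEuclidean.snd * p.t) ≠ 0 := (Real.sqrt_pos.2 (mul_pos p.t_pos p.t_pos)).ne'
  have lim : ContinuousAt (fun v : WithLp 2 (ℂ × ℝ) => dist v p.toEuclidean / √(v.snd * p.t))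
      p.toEuclidean := by
    fun_prop (disch := exact hp)
  refine squeeze_zero (fun _ => dist_nonneg) (fun q => dist_le_dist_toEuclidean_div_sqrt q p) ?_
  have lim_zero := lim.tendsto.comp (tendsto_comap (f := toEuclidean))
  rwa [dist_self, zero_div] at lim_zero

theorem toEuclidean_injective : Function.Injective toEuclidean := fun _ _ h =>
  H3.ext (congrArg WithLp.fst h) (congrArg WithLp.snd h)

theorem norm_toEuclidean_pos (p : H3) : 0 < ‖p.toEuclidean‖ :=
  norm_pos_iff.2 fun h => p.t_pos.ne' (congrArg WithLp.snd h)

theorem inversion_zero_one_snd (v : WithLp 2 (ℂ × ℝ)) :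
    (EuclideanGeometry.inversion 0 1 v).snd = v.snd / ‖v‖ ^ 2 := by
  simp [EuclideanGeometry.inversion, inv_mul_eq_div]

/-- The isometry induced by inversion in the unit sphere; it exchanges the ideal points `0` and
`∞`. -/
noncomputable def inversion (p : H3) : H3 where
  z := (EuclideanGeometry.inversion 0 1 p.toEuclidean).fst
  t := (EuclideanGeometry.inversion 0 1 p.toEuclidean).snd
  t_pos := by
    rw [inversion_zero_one_snd]
    exact div_pos p.t_pos (pow_pos (norm_toEuclidean_pos p) 2)

theorem toEuclidean_inversion (p : H3) :
    p.inversion.toEuclidean = EuclideanGeometry.inversion 0 1 p.toEuclidean := rfl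

theorem t_inversion (p : H3) : p.inversion.t = p.t / ‖p.toEuclidean‖ ^ 2 :=
  inversion_zero_one_snd _

theorem involutive_inversion : Function.Involutive inversion := fun p =>
  toEuclidean_injective (EuclideanGeometry.inversion_inversion 0 one_ne_zero p.toEuclidean)

theorem isometry_inversion : Isometry inversion := by
  refine Isometry.of_dist_eq fun p q => ?_
  have hp := norm_toEuclidean_pos p
  have hq := norm_toEuclidean_pos q
  have := p.t_pos
  have := q.t_pos
  have hsqrt : √(p.inversion.t * q.inversion.t) =
      √(p.t * q.t) / (‖p.toEuclidean‖ * ‖q.toEuclidean‖) := by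
    rw [t_inversion, t_inversion, div_mul_div_comm, ← mul_pow, Real.sqrt_div (by positivity),
      Real.sqrt_sq (by positivity)]
  rw [dist_def, dist_def, hsqrt, toEuclidean_inversion, toEuclidean_inversion,
    EuclideanGeometry.dist_inversion_inversion (norm_pos_iff.1 hp) (norm_pos_iff.1 hq),
    dist_zero_right, dist_zero_right]
  congr 2
  field_simp

theorem inversion_origin : origin.inversion = origin := by
  have : ‖origin.toEuclidean‖ = 1 := by
    simp [origin, toEuclidean]
  refine toEuclidean_injective (EuclideanGeometry.inversion_of_mem_sphere ?_)
  simpa using this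

end H3

namespace ClosedH3

theorem toOnePoint_injective : Function.Injective toOnePoint := by
  have interior_ne_ideal (p : H3) (ξ : RiemannSphere) :
      toOnePoint (interior p) ≠ toOnePoint (ideal ξ) := by
    induction ξ using OnePoint.rec with
    | infty => exact OnePoint.coe_ne_infty _
    | coe z => exact fun h => p.t_pos.ne' (congrArg Prod.snd (OnePoint.coe_injective h))
  rintro (p | ξ) (q | η) h
  · have hpq := OnePoint.coe_injective h
    exact congrArg interior (H3.ext (congrArg Prod.fst hpq) (congrArg Prod.snd hpq))
  · exact absurd h (interior_ne_ideal p η)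
  · exact absurd h.symm (interior_ne_ideal q ξ)
  · exact congrArg ideal (Option.map_injective (Prod.mk_left_injective 0) h)

theorem range_toOnePoint : range toOnePoint = ((↑) '' {v : ℂ × ℝ | v.2 < 0})ᶜ := by
  ext x
  cases x with
  | infty => exact iff_of_true ⟨ideal OnePoint.infty, rfl⟩ OnePoint.infty_notMem_image_coe
  | coe v =>
    rw [mem_compl_iff, OnePoint.coe_injective.mem_set_image, mem_ofPred_eq, not_lt]
    constructor
    · rintro ⟨p | ξ, h⟩
      · exact OnePoint.coe_injective h ▸ p.t_pos.le
      · induction ξ using OnePoint.rec with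
        | infty => exact absurd h (OnePoint.infty_ne_coe v)
        | coe z => exact OnePoint.coe_injective h ▸ le_rfl
    · intro h
      rcases h.eq_or_lt with h | h
      · exact ⟨ideal v.1, congrArg (fun t => (((v.1, t) : ℂ × ℝ) : OnePoint (ℂ × ℝ))) h⟩
      · exact ⟨interior ⟨v.1, v.2, h⟩, rfl⟩

theorem isClosedEmbedding_toOnePoint : IsClosedEmbedding toOnePoint where
  eq_induced := rfl
  injective := toOnePoint_injective
  isClosed_range := by
    rw [range_toOnePoint, isClosed_compl_iff]
    exact OnePoint.isOpenEmbedding_coe.isOpenMap _ (isOpen_lt continuous_snd continuous_const)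

instance : CompactSpace ClosedH3 := isClosedEmbedding_toOnePoint.compactSpace

instance : T2Space ClosedH3 := isClosedEmbedding_toOnePoint.isEmbedding.t2Space

/-- The inclusion of closed hyperbolic space in the one-point compactification of Euclidean space.
It differs from `toOnePoint` in that inversions are available on the target. -/
noncomputable def toOnePointEuclidean (x : ClosedH3) : OnePoint (WithLp 2 (ℂ × ℝ)) :=
  (WithLp.homeomorphProd 2 ℂ ℝ).symm.onePointCongr (toOnePoint x)

theorem isClosedEmbedding_toOnePointEuclidean : IsClosedEmbedding toOnePointEuclidean :=
  (WithLp.homeomorphProd 2 ℂ ℝ).symm.onePointCongr.isClosedEmbedding.comp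
    isClosedEmbedding_toOnePoint

theorem toOnePointEuclidean_interior (p : H3) :
    toOnePointEuclidean (interior p) = p.toEuclidean := rfl

theorem toOnePointEuclidean_ideal_coe (z : ℂ) :
    toOnePointEuclidean (ideal z) = (WithLp.toLp 2 (z, 0) : WithLp 2 (ℂ × ℝ)) := rfl

theorem toOnePointEuclidean_ideal_infty :
    toOnePointEuclidean (ideal OnePoint.infty) = OnePoint.infty := rfl

theorem comap_interior_nhds (x : ClosedH3) :
    comap interior (𝓝 x) = comap H3.toEuclidean (comap (↑) (𝓝 (toOnePointEuclidean x))) := by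
  rw [isClosedEmbedding_toOnePointEuclidean.nhds_eq_comap, comap_comap, comap_comap]
  rfl

theorem comap_interior_nhds_interior (p : H3) :
    comap interior (𝓝 (interior p)) = comap H3.toEuclidean (𝓝 p.toEuclidean) := by
  rw [comap_interior_nhds, toOnePointEuclidean_interior, OnePoint.comap_coe_nhds]

theorem comap_interior_nhds_ideal_coe (z : ℂ) :
    comap interior (𝓝 (ideal z)) = comap H3.toEuclidean (𝓝 (WithLp.toLp 2 (z, 0))) := by
  rw [comap_interior_nhds, toOnePointEuclidean_ideal_coe, OnePoint.comap_coe_nhds]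

theorem comap_interior_nhds_ideal_infty :
    comap interior (𝓝 (ideal OnePoint.infty)) =
      comap H3.toEuclidean (Bornology.cobounded (WithLp 2 (ℂ × ℝ))) := by
  rw [comap_interior_nhds, toOnePointEuclidean_ideal_infty, OnePoint.comap_coe_nhds_infty,
    coclosedCompact_eq_cocompact, Metric.cobounded_eq_cocompact]

theorem isInducing_interior : IsInducing interior :=
  isInducing_iff_nhds.2 fun p => by
    rw [comap_interior_nhds_interior, H3.isInducing_toEuclidean.nhds_eq_comap]

theorem isClosedEmbedding_ideal : IsClosedEmbedding ideal := by
  have hc : IsClosedEmbedding fun z : ℂ => ((z, 0) : ℂ × ℝ) :=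
    Function.LeftInverse.isClosedEmbedding (f := Prod.fst) (fun _ => rfl) continuous_fst
      (by fun_prop)
  refine Continuous.isClosedEmbedding ?_ fun ξ η h => by injection h
  rw [isClosedEmbedding_toOnePoint.isInducing.continuous_iff]
  refine OnePoint.continuous_map hc.continuous ?_
  rw [coclosedCompact_eq_cocompact, coclosedCompact_eq_cocompact]
  exact hc.tendsto_cocompact

theorem ideal_coe_mem_closure_range_interior (z : ℂ) : ideal z ∈ closure (range interior) := by
  let p (n : ℕ) : H3 := ⟨z, 1 / ((n : ℝ) + 1), by positivity⟩
  have hp : Tendsto p atTop (comap interior (𝓝 (ideal z))) := by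
    rw [comap_interior_nhds_ideal_coe, tendsto_comap_iff]
    exact ((WithLp.prod_continuous_toLp 2 ℂ ℝ).tendsto _).comp
      (tendsto_const_nhds.prodMk_nhds tendsto_one_div_add_atTop_nhds_zero_nat)
  exact mem_closure_of_tendsto (tendsto_comap_iff.1 hp)
    (Eventually.of_forall fun n => mem_range_self (p n))

theorem denseRange_interior : DenseRange interior := by
  rintro (p | ξ)
  · exact subset_closure (mem_range_self p)
  · have h : MapsTo ideal (range ((↑) : ℂ → RiemannSphere)) (closure (range interior)) := by
      rintro _ ⟨z, rfl⟩
      exact ideal_coe_mem_closure_range_interior z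
    simpa only [closure_closure] using
      map_mem_closure isClosedEmbedding_ideal.continuous (OnePoint.denseRange_coe ξ) h

theorem isDenseInducing_interior : IsDenseInducing interior where
  toIsInducing := isInducing_interior
  dense := denseRange_interior

instance comap_interior_nhds_neBot (x : ClosedH3) : NeBot (comap interior (𝓝 x)) :=
  isDenseInducing_interior.comap_nhds_neBot x

theorem eq_of_comap_interior_nhds_le {x y : ClosedH3}
    (h : comap interior (𝓝 x) ≤ comap interior (𝓝 y)) : x = y :=
  tendsto_nhds_unique (f := interior) tendsto_comap (map_le_iff_le_comap.2 h)

theorem tendsto_inversion :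
    Tendsto H3.inversion (comap interior (𝓝 (ideal OnePoint.infty)))
      (comap interior (𝓝 (ideal (0 : ℂ)))) := by
  rw [comap_interior_nhds_ideal_infty, comap_interior_nhds_ideal_coe, tendsto_comap_iff]
  exact (tendsto_inversion_cobounded 0 1).comp tendsto_comap

theorem tendsto_dist_origin_coe (z : ℂ) :
    Tendsto (dist H3.origin) (comap interior (𝓝 (ideal z))) atTop := by
  have ht : Tendsto H3.t (comap interior (𝓝 (ideal z))) (𝓝[>] 0) := by
    refine tendsto_nhdsWithin_iff.2 ⟨?_, Eventually.of_forall H3.t_pos⟩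
    rw [comap_interior_nhds_ideal_coe]
    exact ((WithLp.prod_continuous_ofLp 2 ℂ ℝ).snd.tendsto _).comp tendsto_comap
  exact tendsto_atTop_mono H3.neg_log_t_le_dist_origin
    (tendsto_neg_atBot_atTop.comp (Real.tendsto_log_nhdsGT_zero.comp ht))

theorem tendsto_dist_origin (ξ : RiemannSphere) :
    Tendsto (dist H3.origin) (comap interior (𝓝 (ideal ξ))) atTop := by
  induction ξ using OnePoint.rec with
  | infty =>
    refine ((tendsto_dist_origin_coe 0).comp tendsto_inversion).congr fun p => ?_
    rw [Function.comp_apply, ← H3.isometry_inversion.dist_eq H3.origin p, H3.inversion_origin]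
  | coe z => exact tendsto_dist_origin_coe z

/-- The ball model: inversion in the sphere with center `(0, -1)` and radius `√2` maps the upper
half space to the unit ball and `H3.origin` to its center. -/
noncomputable def toBall (x : ClosedH3) : WithLp 2 (ℂ × ℝ) :=
  inversionOnePoint H3.origin.mirror (√2) (toOnePointEuclidean x)

theorem toOnePointEuclidean_ne_mirror (x : ClosedH3) (p : H3) :
    toOnePointEuclidean x ≠ p.mirror := by
  have hp := p.t_pos
  rcases x with q | ξ
  · have hq := q.t_pos
    exact fun h => absurd (congrArg WithLp.snd (OnePoint.coe_injective h))
      (show q.t ≠ -p.t by linarith)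
  · induction ξ using OnePoint.rec with
    | infty => exact OnePoint.infty_ne_coe _
    | coe z =>
      exact fun h => absurd (congrArg WithLp.snd (OnePoint.coe_injective h))
        (show (0 : ℝ) ≠ -p.t by linarith)

theorem isClosedEmbedding_toBall : IsClosedEmbedding toBall := by
  refine Continuous.isClosedEmbedding ?_ fun x y h => ?_
  · exact continuous_iff_continuousAt.2 fun x =>
      (continuousAt_inversionOnePoint _ (toOnePointEuclidean_ne_mirror x _)).comp
        isClosedEmbedding_toOnePointEuclidean.continuous.continuousAt
  · exact isClosedEmbedding_toOnePointEuclidean.injective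
      (injOn_inversionOnePoint _ (by positivity) (toOnePointEuclidean_ne_mirror x _)
        (toOnePointEuclidean_ne_mirror y _) h)

theorem dist_toBall_interior (p q : H3) :
    dist (toBall (interior p)) (toBall (interior q)) = Real.sinh (dist p q / 2) /
      (Real.cosh (dist H3.origin p / 2) * Real.cosh (dist H3.origin q / 2)) := by
  have hp := p.t_pos
  have hq := q.t_pos
  have ne_center (x : H3) : x.toEuclidean ≠ H3.origin.mirror := fun h =>
    toOnePointEuclidean_ne_mirror (interior x) H3.origin (congrArg _ h)
  have dist_center (x : H3) : dist x.toEuclidean H3.origin.mirror =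
      2 * √x.t * Real.cosh (dist H3.origin x / 2) := by
    rw [H3.dist_toEuclidean_mirror, dist_comm x, H3.origin, mul_one]
  have hdist := EuclideanGeometry.dist_inversion_inversion (ne_center p) (ne_center q) √2
  rw [dist_center, dist_center, H3.dist_toEuclidean, Real.sqrt_mul hp.le,
    Real.sq_sqrt zero_le_two] at hdist
  refine hdist.trans ?_
  have := Real.cosh_pos (dist H3.origin p / 2)
  have := Real.cosh_pos (dist H3.origin q / 2)
  field_simp

theorem dist_toBall_interior_le (p q : H3) :
    dist (toBall (interior p)) (toBall (interior q)) ≤ 4 * Real.sinh (dist p q / 2) *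
      Real.exp (-((dist H3.origin p + dist H3.origin q) / 2)) := by
  have exp_le (x : ℝ) : Real.exp x / 2 ≤ Real.cosh x := by
    rw [Real.cosh_eq]
    linarith [Real.exp_pos (-x)]
  have : 0 ≤ Real.sinh (dist p q / 2) := Real.sinh_nonneg_iff.2 (by positivity)
  calc dist (toBall (interior p)) (toBall (interior q))
      = Real.sinh (dist p q / 2) /
          (Real.cosh (dist H3.origin p / 2) * Real.cosh (dist H3.origin q / 2)) :=
        dist_toBall_interior p q
    _ ≤ Real.sinh (dist p q / 2) /
          (Real.exp (dist H3.origin p / 2) / 2 * (Real.exp (dist H3.origin q / 2) / 2)) := by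
        gcongr <;> apply exp_le
    _ = 4 * Real.sinh (dist p q / 2) *
          Real.exp (-((dist H3.origin p + dist H3.origin q) / 2)) := by
        rw [add_div, Real.exp_neg, Real.exp_add]
        field_simp
        ring

end ClosedH3

namespace H3

theorem dist_le_one_of_z_eq {x y : H3} (hz : x.z = y.z) (hxy : x.t ≤ y.t)
    (hyx : y.t ≤ 2 * x.t) : dist x y ≤ 1 :=
  dist_le_one_of_sq_le <| by
    rw [hz, dist_self]
    nlinarith [x.t_pos]

theorem dist_le_one_of_t_eq {x y : H3} (ht : x.t = y.t) (hz : dist x.z y.z ≤ y.t) :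
    dist x y ≤ 1 :=
  dist_le_one_of_sq_le <| by
    rw [ht, sub_self]
    nlinarith [dist_nonneg (x := x.z) (y := y.z)]

/-- Steps of hyperbolic length at most one, taken at height at most `r`, have size at most
`C * r ^ α` under `f`. Read in the ball model, this is how quasi-isometric embeddings behave near
the finite part of the ideal boundary. -/
def HasStepDecay {Y : Type*} [PseudoMetricSpace Y] (f : H3 → Y) (C α : ℝ) : Prop :=
  ∀ ⦃x y : H3⦄ ⦃r : ℝ⦄, x.t ≤ r → y.t ≤ r → dist x y ≤ 1 → dist (f x) (f y) ≤ C * r ^ α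

namespace HasStepDecay

variable {Y : Type*} [PseudoMetricSpace Y] {f : H3 → Y} {C α : ℝ}

theorem nonneg (hf : HasStepDecay f C α) : 0 ≤ C := by
  have h := hf (x := origin) (y := origin) (r := 1) le_rfl le_rfl (by simp)
  rwa [dist_self, Real.one_rpow, mul_one] at h

theorem dist_le_of_z_eq (hf : HasStepDecay f C α) (hα : 0 < α) {x y : H3} (hz : x.z = y.z)
    (hxy : x.t ≤ y.t) : dist (f x) (f y) ≤ C / (1 - 2⁻¹ ^ α) * y.t ^ α := by
  obtain ⟨n, hn⟩ : ∃ n : ℕ, y.t ≤ 2 ^ n * x.t := by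
    obtain ⟨n, hn⟩ := pow_unbounded_of_one_lt (y.t / x.t) one_lt_two
    exact ⟨n, ((div_lt_iff₀ x.t_pos).1 hn).le⟩
  have hc : 0 < 1 - (2⁻¹ : ℝ) ^ α :=
    sub_pos.2 (Real.rpow_lt_one (by norm_num) (by norm_num) hα)
  have hC := hf.nonneg
  induction n generalizing y with
  | zero =>
    obtain rfl : x = y := H3.ext hz (hxy.antisymm (by simpa using hn))
    have := x.t_pos
    rw [dist_self]
    positivity
  | succ n ih =>
    have hy := y.t_pos
    rcases le_total y.t (2 * x.t) with hyx | hyx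
    · refine (hf hxy le_rfl (dist_le_one_of_z_eq hz hxy hyx)).trans ?_
      gcongr
      exact le_div_self hC hc (sub_le_self _ (by positivity))
    · let m : H3 := ⟨y.z, 2⁻¹ * y.t, by positivity⟩
      have hm : m.t = 2⁻¹ * y.t := rfl
      have below : dist (f x) (f m) ≤ C / (1 - 2⁻¹ ^ α) * m.t ^ α :=
        ih hz (by linarith) (by rw [pow_succ] at hn; linarith)
      have step : dist (f m) (f y) ≤ C * y.t ^ α :=
        hf (by linarith) le_rfl (dist_le_one_of_z_eq rfl (by linarith) (by linarith))
      rw [hm, Real.mul_rpow (by norm_num) hy.le] at below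
      have sum : C / (1 - 2⁻¹ ^ α) * 2⁻¹ ^ α + C = C / (1 - 2⁻¹ ^ α) := by
        rw [div_mul_eq_mul_div, div_add' _ _ _ hc.ne']
        ring
      calc dist (f x) (f y) ≤ dist (f x) (f m) + dist (f m) (f y) := dist_triangle _ _ _
        _ ≤ C / (1 - 2⁻¹ ^ α) * (2⁻¹ ^ α * y.t ^ α) + C * y.t ^ α := add_le_add below step
        _ = C / (1 - 2⁻¹ ^ α) * y.t ^ α := by
          rw [← mul_assoc, ← add_mul, sum]

theorem dist_le_of_dist_z_le (hf : HasStepDecay f C α) (hα : 0 < α) {x y : H3}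
    (hz : dist x.z y.z ≤ y.t) (hxy : x.t ≤ y.t) :
    dist (f x) (f y) ≤ (C / (1 - 2⁻¹ ^ α) + C) * y.t ^ α := by
  let m : H3 := ⟨x.z, y.t, y.t_pos⟩
  have vertical : dist (f x) (f m) ≤ C / (1 - 2⁻¹ ^ α) * y.t ^ α :=
    hf.dist_le_of_z_eq hα rfl hxy
  have horizontal : dist (f m) (f y) ≤ C * y.t ^ α :=
    hf le_rfl le_rfl (dist_le_one_of_t_eq rfl hz)
  rw [add_mul]
  exact (dist_triangle _ _ _).trans (add_le_add vertical horizontal)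

theorem cauchy_map (hf : HasStepDecay f C α) (hα : 0 < α) (z : ℂ) :
    Cauchy (map f (comap ClosedH3.interior (𝓝 (ClosedH3.ideal z)))) := by
  refine Metric.cauchy_iff.2 ⟨inferInstance, fun ε hε => ?_⟩
  have lim : Tendsto (fun r : ℝ => (C / (1 - 2⁻¹ ^ α) + C) * r ^ α) (𝓝[>] 0) (𝓝 0) := by
    have h := (Real.continuousAt_rpow_const 0 α (Or.inr hα.le)).const_mul (C / (1 - 2⁻¹ ^ α) + C)
    have h0 := h.tendsto
    rw [Real.zero_rpow hα.ne', mul_zero] at h0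
    exact h0.mono_left nhdsWithin_le_nhds
  obtain ⟨r, hr, hr0 : 0 < r⟩ :=
    ((lim.eventually_lt_const (half_pos hε)).and self_mem_nhdsWithin).exists
  have near (p : H3) (hp : dist p.toEuclidean (WithLp.toLp 2 (z, 0)) < r) :
      dist (f p) (f ⟨z, r, hr0⟩) < ε / 2 := by
    have hz := WithLp.dist_fst_le p.toEuclidean (WithLp.toLp 2 (z, 0))
    have ht := WithLp.dist_snd_le p.toEuclidean (WithLp.toLp 2 (z, 0))
    have ht' : p.t ≤ dist p.t 0 := Real.dist_0_eq_abs p.t ▸ le_abs_self p.t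
    exact (hf.dist_le_of_dist_z_le hα (hz.trans hp.le) (ht'.trans (ht.trans hp.le))).trans_lt hr
  refine ⟨f '' (toEuclidean ⁻¹' Metric.ball (WithLp.toLp 2 (z, 0)) r), image_mem_map ?_, ?_⟩
  · rw [ClosedH3.comap_interior_nhds_ideal_coe]
    exact preimage_mem_comap (Metric.ball_mem_nhds _ hr0)
  · rintro _ ⟨p, hp, rfl⟩ _ ⟨q, hq, rfl⟩
    linarith [dist_triangle_right (f p) (f q) (f ⟨z, r, hr0⟩), near p hp, near q hq]

end HasStepDecay

end H3

open ClosedH3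

namespace IsQuasiIsometricEmbedding

variable {F : H3 → H3}

theorem exists_hasStepDecay (hF : IsQuasiIsometricEmbedding F) :
    ∃ C α : ℝ, 0 < α ∧ H3.HasStepDecay (toBall ∘ interior ∘ F) C α := by
  obtain ⟨α, b, hα, far⟩ := hF.exists_mul_dist_sub_le_dist H3.origin H3.origin
  obtain ⟨D, short⟩ := hF.exists_dist_le_of_dist_le 1
  refine ⟨4 * Real.sinh (D / 2) * Real.exp b, α, hα, fun x y r hx hy hxy => ?_⟩
  have hr : 0 < r := x.t_pos.trans_le hx
  have le_dist {p : H3} (hp : p.t ≤ r) : -(α * Real.log r) - b ≤ dist H3.origin (F p) := by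
    have hlog : -Real.log r ≤ dist H3.origin p :=
      (neg_le_neg (Real.log_le_log p.t_pos hp)).trans (H3.neg_log_t_le_dist_origin p)
    linarith [mul_le_mul_of_nonneg_left hlog hα.le, far p]
  calc dist (toBall (interior (F x))) (toBall (interior (F y)))
      ≤ 4 * Real.sinh (dist (F x) (F y) / 2) *
          Real.exp (-((dist H3.origin (F x) + dist H3.origin (F y)) / 2)) :=
        dist_toBall_interior_le _ _
    _ ≤ 4 * Real.sinh (D / 2) * Real.exp (b + Real.log r * α) := by
        have hD := Real.sinh_le_sinh.2 (div_le_div_of_nonneg_right (short x y hxy) zero_le_two)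
        have hs : 0 ≤ Real.sinh (dist (F x) (F y) / 2) := Real.sinh_nonneg_iff.2 (by positivity)
        have hdist := add_le_add (le_dist hx) (le_dist hy)
        gcongr
        · linarith
        · linarith
    _ = 4 * Real.sinh (D / 2) * Real.exp b * r ^ α := by
        rw [Real.exp_add, Real.rpow_def_of_pos hr, mul_assoc _ (Real.exp b)]

theorem exists_tendsto_coe (hF : IsQuasiIsometricEmbedding F) (z : ℂ) :
    ∃ x, Tendsto (interior ∘ F) (comap interior (𝓝 (ideal z))) (𝓝 x) := by
  obtain ⟨C, α, hα, decay⟩ := hF.exists_hasStepDecay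
  obtain ⟨v, hv : Tendsto _ _ _⟩ := CompleteSpace.complete (decay.cauchy_map hα z)
  obtain ⟨x, rfl⟩ : v ∈ range toBall := isClosedEmbedding_toBall.isClosed_range.mem_of_tendsto hv
    (Eventually.of_forall fun p => mem_range_self _)
  exact ⟨x, isClosedEmbedding_toBall.isInducing.tendsto_nhds_iff.2 hv⟩

theorem exists_tendsto (hF : IsQuasiIsometricEmbedding F) (ξ : RiemannSphere) :
    ∃ x, Tendsto (interior ∘ F) (comap interior (𝓝 (ideal ξ))) (𝓝 x) := by
  induction ξ using OnePoint.rec with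
  | infty =>
    obtain ⟨x, hx⟩ := (hF.comp_isometry H3.isometry_inversion).exists_tendsto_coe 0
    refine ⟨x, (hx.comp tendsto_inversion).congr fun p => ?_⟩
    simp only [Function.comp_apply, H3.involutive_inversion p]
  | coe z => exact hF.exists_tendsto_coe z

theorem exists_tendsto_ideal (hF : IsQuasiIsometricEmbedding F) (ξ : RiemannSphere) :
    ∃ η, Tendsto F (comap interior (𝓝 (ideal ξ))) (comap interior (𝓝 (ideal η))) := by
  obtain ⟨q | η, hx⟩ := hF.exists_tendsto ξ
  · obtain ⟨α, b, hα, far⟩ := hF.exists_mul_dist_sub_le_dist H3.origin H3.origin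
    have bounded : Tendsto (fun p => dist H3.origin (F p)) (comap interior (𝓝 (ideal ξ)))
        (𝓝 (dist H3.origin q)) :=
      tendsto_const_nhds.dist (isInducing_interior.tendsto_nhds_iff.2 hx)
    have unbounded : Tendsto (fun p => dist H3.origin (F p)) (comap interior (𝓝 (ideal ξ))) atTop :=
      tendsto_atTop_mono far
        (tendsto_atTop_add_const_right _ (-b) ((tendsto_dist_origin ξ).const_mul_atTop hα))
    exact absurd bounded (not_tendsto_nhds_of_tendsto_atTop unbounded _)
  · exact ⟨η, tendsto_comap_iff.2 hx⟩

end IsQuasiIsometricEmbedding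

namespace ExtendsContinuouslyTo

variable {F G : H3 → H3} {f g : RiemannSphere → RiemannSphere}

theorem of_tendsto (hF : Continuous F)
    (hf : ∀ ξ, Tendsto F (comap interior (𝓝 (ideal ξ))) (comap interior (𝓝 (ideal (f ξ))))) :
    ExtendsContinuouslyTo F f := by
  have tendsto_glue (x : ClosedH3) :
      Tendsto (interior ∘ F) (comap interior (𝓝 x)) (𝓝 (glue F f x)) := by
    rcases x with p | ξ
    · rw [← isInducing_interior.nhds_eq_comap]
      exact (isInducing_interior.continuous.comp hF).tendsto p
    · exact tendsto_comap_iff.1 (hf ξ)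
  have glue_eq : glue F f = isDenseInducing_interior.extend (interior ∘ F) :=
    funext fun x => (isDenseInducing_interior.extend_eq_of_tendsto (tendsto_glue x)).symm
  rw [ExtendsContinuouslyTo, glue_eq]
  exact isDenseInducing_interior.continuous_extend fun x => ⟨_, tendsto_glue x⟩

theorem comp (hF : ExtendsContinuouslyTo F f) (hG : ExtendsContinuouslyTo G g) :
    ExtendsContinuouslyTo (F ∘ G) (f ∘ g) := by
  have glue_comp : glue (F ∘ G) (f ∘ g) = glue F f ∘ glue G g := by
    funext x
    rcases x <;> rfl
  rw [ExtendsContinuouslyTo, glue_comp]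
  exact Continuous.comp hF hG

theorem continuous (hF : ExtendsContinuouslyTo F f) : Continuous f :=
  isClosedEmbedding_ideal.isInducing.continuous_iff.2
    (Continuous.comp (g := glue F f) hF isClosedEmbedding_ideal.continuous)

theorem symm {H : Equiv.Perm H3} {h : Equiv.Perm RiemannSphere}
    (hH : ExtendsContinuouslyTo H h) : ExtendsContinuouslyTo H.symm h.symm := by
  let e : Equiv.Perm ClosedH3 :=
    { toFun := glue H h
      invFun := glue H.symm h.symm
      left_inv := by rintro (p | ξ) <;> simp [glue]
      right_inv := by rintro (p | ξ) <;> simp [glue] }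
  exact (Continuous.homeoOfEquivCompactToT2 (f := e) hH).symm.continuous

end ExtendsContinuouslyTo

theorem IsQuasiIsometricEmbedding.exists_homeomorph {H : Equiv.Perm H3}
    (hH : IsQuasiIsometricEmbedding H) (hc : Continuous H) :
    ∃ h : RiemannSphere ≃ₜ RiemannSphere, ExtendsContinuouslyTo H h := by
  choose f hf using hH.exists_tendsto_ideal
  choose g hg using hH.symm.exists_tendsto_ideal
  have hgf (ξ : RiemannSphere) : g (f ξ) = ξ := by
    have h := (hg (f ξ)).comp (hf ξ)
    rw [H.symm_comp_self, tendsto_id'] at h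
    exact (ideal.inj (eq_of_comap_interior_nhds_le h)).symm
  have hfg (ξ : RiemannSphere) : f (g ξ) = ξ := by
    have h := (hf (g ξ)).comp (hg ξ)
    rw [H.self_comp_symm, tendsto_id'] at h
    exact (ideal.inj (eq_of_comap_interior_nhds_le h)).symm
  have extends_f : ExtendsContinuouslyTo H f := .of_tendsto hc hf
  exact ⟨Continuous.homeoOfEquivCompactToT2 (f := ⟨f, g, hgf, hfg⟩) extends_f.continuous, extends_f⟩

theorem IsEquivariant.symm {H : Equiv.Perm H3} {Γ₁ Γ₂ : Subgroup (H3 ≃ᵢ H3)}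
    (hΓ : IsEquivariant H Γ₁ Γ₂) : IsEquivariant H.symm Γ₂ Γ₁ := by
  have h := congrArg (image fun φ : Equiv.Perm H3 => H⁻¹ * φ * H) hΓ
  simp only [image_image] at h
  simpa [IsEquivariant, mul_assoc, ← Equiv.Perm.inv_def] using h.symm

theorem IsEquivariant.mapsTo_boundaryMaps {H : Equiv.Perm H3} {Γ₁ Γ₂ : Subgroup (H3 ≃ᵢ H3)}
    (hΓ : IsEquivariant H Γ₁ Γ₂) {h : RiemannSphere ≃ₜ RiemannSphere}
    (hH : ExtendsContinuouslyTo H h) :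
    MapsTo (fun k => h * k * h⁻¹) (boundaryMaps Γ₁) (boundaryMaps Γ₂) := by
  rintro k ⟨g, hg, hk⟩
  obtain ⟨g', hg', conj⟩ := hΓ.subset (mem_image_of_mem _ hg)
  have coe_g' : (g' : H3 → H3) = (H ∘ g) ∘ H.symm := congrArg DFunLike.coe conj
  refine ⟨g', hg', ?_⟩
  rw [coe_g']
  exact (hH.comp hk).comp (hH.symm (h := h.toEquiv))

theorem IsEquivariant.isBoundaryEquivariant {H : Equiv.Perm H3} {Γ₁ Γ₂ : Subgroup (H3 ≃ᵢ H3)}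
    (hΓ : IsEquivariant H Γ₁ Γ₂) {h : RiemannSphere ≃ₜ RiemannSphere}
    (hH : ExtendsContinuouslyTo H h) : IsBoundaryEquivariant h Γ₁ Γ₂ := by
  refine (hΓ.mapsTo_boundaryMaps hH).image_subset.antisymm fun k hk => ?_
  have hk' := hΓ.symm.mapsTo_boundaryMaps (h := h⁻¹) (hH.symm (h := h.toEquiv)) hk
  exact ⟨_, hk', by simp [mul_assoc]⟩

theorem theorem2_general (H : Equiv.Perm H3) (hH : IsQuasiIsometricEmbedding H)
    (hc : Continuous H) :
    ∃ h : RiemannSphere ≃ₜ RiemannSphere, ExtendsContinuouslyTo H h ∧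
      ∀ Γ₁ Γ₂ : Subgroup (H3 ≃ᵢ H3), IsEquivariant H Γ₁ Γ₂ → IsBoundaryEquivariant h Γ₁ Γ₂ := by
  obtain ⟨h, hh⟩ := hH.exists_homeomorph hc
  exact ⟨h, hh, fun _ _ hΓ => hΓ.isBoundaryEquivariant hh⟩

theorem theorem2 (H : Equiv.Perm H3) (hH : IsBL H) :
    ∃ h : RiemannSphere ≃ₜ RiemannSphere, ExtendsContinuouslyTo H h ∧
      ∀ Γ₁ Γ₂ : Subgroup (H3 ≃ᵢ H3), IsNiceLattice Γ₁ → IsNiceLattice Γ₂ →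
        IsEquivariant H Γ₁ Γ₂ → IsBoundaryEquivariant h Γ₁ Γ₂ := by
  obtain ⟨h, hh, equivariant⟩ := theorem2_general H hH.isQuasiIsometricEmbedding hH.continuous
  exact ⟨h, hh, fun Γ₁ Γ₂ _ _ => equivariant Γ₁ Γ₂⟩
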